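/- All graphs are finite, simple and undirected. A hole is a chordless (induced) cycle of length at least four; it is even if its length is even. A cap is a graph consisting of a hole together with one additional vertex that is adjacent to exactly two vertices of the hole, these two being adjacent. A graph is (even-hole, cap)-free if it contains no even hole and no cap as an induced subgraph. A vertex is universal if it is adjacent to all other vertices. Two distinct vertices $u,v$ are twins if $N[u]=N[v]$, where $N[v]$ denotes the closed neighbourhood of $v$. A clique cutset of $G$ is a clique $S\subseteq V(G)$ such that $G-S$ has more connected components than $G$. Theorem. Let $G$ be a connected (even-hole, cap)-free graph that contains no universal vertex, no pair of twin vertices and no clique cutset. Then $G$ is triangle-free. -/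

import Mathlib

namespace SimpleGraph

variable {V : Type*}

/-- `G` contains no even hole as an induced subgraph, i.e. it is `{C₄, C₆, …}`-free. -/
def EvenHoleFree (G : SimpleGraph V) : Prop :=
  ∀ n : ℕ, 4 ≤ n → Even n → ¬ (cycleGraph n).IsIndContained G

/-- `G` contains a cap: a hole (an induced cycle of length at least four, given by an induced
embedding of `cycleGraph n`) together with a vertex off the hole whose neighbours on the hole are
exactly two vertices, and these are adjacent. -/
def ContainsCap (G : SimpleGraph V) : Prop :=
  ∃ n : ℕ, 4 ≤ n ∧ ∃ hole : cycleGraph n ↪g G, ∃ x : V, x ∉ Set.range hole ∧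
    ∃ i j : Fin n, (cycleGraph n).Adj i j ∧ ∀ k : Fin n, G.Adj x (hole k) ↔ k = i ∨ k = j

/-- `G` contains no cap as an induced subgraph. -/
def CapFree (G : SimpleGraph V) : Prop := ¬ G.ContainsCap

/-- The closed neighbourhood `N[v]`. -/
def closedNeighborSet (G : SimpleGraph V) (v : V) : Set V := insert v (G.neighborSet v)

/-- `u` and `v` are (distinct) twin vertices: `N[u] = N[v]`. -/
def AreTwins (G : SimpleGraph V) (u v : V) : Prop :=
  u ≠ v ∧ G.closedNeighborSet u = G.closedNeighborSet v

/-- `G - S` has more connected components than `G` (used for finite graphs). -/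
def IsCutset (G : SimpleGraph V) (S : Set V) : Prop :=
  Nat.card G.ConnectedComponent < Nat.card (G.induce Sᶜ).ConnectedComponent

/-- A cutset that is also a clique. -/
def IsCliqueCutset (G : SimpleGraph V) (S : Set V) : Prop :=
  G.IsClique S ∧ G.IsCutset S

end SimpleGraph

namespace SimpleGraph

variable {V : Type*} {G : SimpleGraph V}

/-! A core is a vertex set inducing a noncomplete triangle-free graph without clique cutset. A
noncomplete graph without clique cutset contains a hole, and a hole is a core
(`NoCliqueSep.exists_isCore`); let `F` be a core with the most vertices. The plan is to show that
`F` is everything.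

A vertex with two adjacent neighbours in `F` is complete to `F` or has the closed neighbourhood in
`F` of some vertex of `F` (`IsCore.complete_or_twin`). Any other vertex off `F` has at most one
neighbour in `F`, by maximality (`IsMaxCore.isPendant`). A component of such pendant vertices
attaches to the rest in a clique: twins can be swapped into `F` (`IsMaxCore.replace`), and a minimal
connected set joining two nonadjacent vertices of `F` is an induced path that enlarges the core
(`NoCliqueSep.union`, `IsMaxCore.not_isLink`). As there is no clique cutset, there are no pendant
vertices.

Thus every vertex is complete to `F` or a twin over `F`. Adjacency of twins is decided by the
vertices they copy, so a complete vertex is universal and two vertices copying the same vertex of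
`F` are twins in `G`. Neither exists, so every vertex lies in `F`. -/

/-! ### Connected sets and induced paths. -/

/-- `v` has a neighbour in `A`. -/
def Touches (G : SimpleGraph V) (v : V) (A : Set V) : Prop := ∃ a ∈ A, G.Adj v a

lemma Touches.mono {v : V} {A B : Set V} (h : G.Touches v A) (hAB : A ⊆ B) : G.Touches v B :=
  let ⟨a, ha, hv⟩ := h
  ⟨a, hAB ha, hv⟩

/-- `C` induces a connected subgraph: a nonempty part of `C` closed under taking neighbours in `C`
is all of `C`. -/
def IsConnSet (G : SimpleGraph V) (C : Set V) : Prop :=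
  ∀ A ⊆ C, A.Nonempty → (∀ a ∈ A, ∀ b ∈ C, G.Adj a b → b ∈ A) → C ⊆ A

lemma isConnSet_singleton (v : V) : G.IsConnSet {v} := by
  rintro A hA ⟨a, ha⟩ - w rfl
  have : a = w := hA ha
  exact this ▸ ha

lemma IsConnSet.insert {D : Set V} (hD : G.IsConnSet D) {v : V} (hv : G.Touches v D) :
    G.IsConnSet (insert v D) := by
  obtain ⟨d, hd, hvd⟩ := hv
  intro A hA hne hcl
  have hdA : d ∈ A := by
    by_cases h : (A ∩ D).Nonempty
    · exact (hD (A ∩ D) Set.inter_subset_right h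
        (fun a ha b hb hab => ⟨hcl a ha.1 b (Or.inr hb) hab, hb⟩) hd).1
    · obtain ⟨a, ha⟩ := hne
      rcases hA ha with rfl | h'
      · exact hcl _ ha d (Or.inr hd) hvd
      · exact absurd ⟨a, ha, h'⟩ h
  have hDA : D ⊆ A := fun x hx =>
    (hD (A ∩ D) Set.inter_subset_right ⟨d, hdA, hd⟩
      (fun a ha b hb hab => ⟨hcl a ha.1 b (Or.inr hb) hab, hb⟩) hx).1
  rintro x (rfl | hx)
  · exact hcl d hdA _ (Or.inl rfl) hvd.symm
  · exact hDA hx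

/-- The component of `c` in the subgraph induced by `X`. -/
lemma exists_component (X : Set V) {c : V} (hc : c ∈ X) :
    ∃ D ⊆ X, c ∈ D ∧ G.IsConnSet D ∧ ∀ d ∈ D, ∀ v ∈ X, G.Adj d v → v ∈ D := by
  let r : V → V → Prop := fun u v => G.Adj u v ∧ u ∈ X ∧ v ∈ X
  have hr : Std.Symm r := ⟨fun u v h => ⟨h.1.symm, h.2.2, h.2.1⟩⟩
  have hX : ∀ v, Relation.ReflTransGen r c v → v ∈ X := by
    intro v hv
    induction hv with
    | refl => exact hc
    | tail _ h _ => exact h.2.2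
  refine ⟨{v | Relation.ReflTransGen r c v}, hX, Relation.ReflTransGen.refl, ?_,
    fun d hd v hv hdv => Relation.ReflTransGen.tail hd ⟨hdv, hX d hd, hv⟩⟩
  rintro A hA ⟨a, ha⟩ hcl x hx
  have hca : Relation.ReflTransGen r c a := hA ha
  have hax : Relation.ReflTransGen r a x :=
    (Relation.ReflTransGen.stdSymm.symm _ _ hca).trans hx
  have : Relation.ReflTransGen r c x ∧ x ∈ A := by
    clear hx
    induction hax with
    | refl => exact ⟨hca, ha⟩
    | tail _ h ih => exact ⟨ih.1.tail h, hcl _ ih.2 _ (ih.1.tail h) h.1⟩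
  exact this.2

/-- `p 0, …, p n` is an induced path. -/
structure IsInducedPath (G : SimpleGraph V) (p : ℕ → V) (n : ℕ) : Prop where
  adj_iff : ∀ i j, i < j → j ≤ n → (G.Adj (p i) (p j) ↔ j = i + 1)
  ne : ∀ i j, i < j → j ≤ n → p i ≠ p j

lemma IsConnSet.exists_sequence {C : Set V} (hC : G.IsConnSet C) {s t : V} (hs : s ∈ C)
    (ht : t ∈ C) : ∃ (n : ℕ) (p : ℕ → V), p 0 = s ∧ p n = t ∧ (∀ i ≤ n, p i ∈ C) ∧
      ∀ i < n, G.Adj (p i) (p (i + 1)) := by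
  let A : Set V := {t | t ∈ C ∧ ∃ (n : ℕ) (p : ℕ → V), p 0 = s ∧ p n = t ∧ (∀ i ≤ n, p i ∈ C) ∧
      ∀ i < n, G.Adj (p i) (p (i + 1))}
  refine (hC A (fun x hx => hx.1) ⟨s, hs, 0, fun _ => s, rfl, rfl, fun _ _ => hs, ?_⟩ ?_ ht).2
  · intro i hi; omega
  · rintro a ⟨_, n, p, h0, hn, hpC, hadj⟩ b hb hab
    refine ⟨hb, n + 1, fun i => if i ≤ n then p i else b, by simpa using h0, by simp, ?_, ?_⟩
    · intro i _
      by_cases h : i ≤ n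
      · simpa [h] using hpC i h
      · simpa [h] using hb
    · intro i hi
      by_cases h : i < n
      · simpa [h.le, Nat.succ_le_of_lt h] using hadj i h
      · obtain rfl : i = n := by omega
        simpa [hn] using hab

/-- A shortest path in `C` from a vertex satisfying `P` to one satisfying `Q`. -/
lemma IsConnSet.exists_inducedPath {C : Set V} (hC : G.IsConnSet C) (P Q : V → Prop)
    (hP : ∃ s ∈ C, P s) (hQ : ∃ t ∈ C, Q t) :
    ∃ (n : ℕ) (p : ℕ → V), G.IsInducedPath p n ∧ (∀ i ≤ n, p i ∈ C) ∧ P (p 0) ∧ Q (p n) ∧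
      (∀ i ≤ n, 0 < i → ¬ P (p i)) ∧ ∀ i < n, ¬ Q (p i) := by
  classical
  let R : ℕ → Prop := fun n => ∃ p : ℕ → V, P (p 0) ∧ Q (p n) ∧ (∀ i ≤ n, p i ∈ C) ∧
      ∀ i < n, G.Adj (p i) (p (i + 1))
  have hR : ∃ n, R n := by
    obtain ⟨s, hs, hPs⟩ := hP
    obtain ⟨t, ht, hQt⟩ := hQ
    obtain ⟨n, p, h0, hn, h1, h2⟩ := hC.exists_sequence hs ht
    exact ⟨n, p, h0 ▸ hPs, hn ▸ hQt, h1, h2⟩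
  obtain ⟨p, hP0, hQn, hpC, hadj⟩ := Nat.find_spec hR
  have hmin : ∀ m < Nat.find hR, ¬ R m := fun m hm => Nat.find_min hR hm
  generalize Nat.find hR = n at *
  -- A chord past `k` interior vertices leaves a walk of length `n - k`, against minimality.
  have shortcut : ∀ i k, i + 1 + k ≤ n → 0 < k → ¬ G.Adj (p i) (p (i + 1 + k)) := by
    intro i k hik hk hij
    refine hmin (n - k) (by omega) ⟨fun l => if l ≤ i then p l else p (l + k), by simpa using hP0,
      ?_, ?_, ?_⟩
    · have h1 : ¬ n - k ≤ i := by omega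
      have h2 : n - k + k = n := by omega
      simpa [h1, h2] using hQn
    · intro l hl
      by_cases h : l ≤ i
      · simpa [h] using hpC l (by omega)
      · simpa [h] using hpC (l + k) (by omega)
    · intro l hl
      rcases lt_trichotomy l i with h | rfl | h
      · simpa [h.le, Nat.succ_le_of_lt h] using hadj l (by omega)
      · simpa using hij
      · have h1 : ¬ l ≤ i := by omega
        have h2 : ¬ l + 1 ≤ i := by omega
        have h3 : l + 1 + k = l + k + 1 := by omega
        simpa [h1, h2, h3] using hadj (l + k) (by omega)
  have hPi : ∀ i ≤ n, 0 < i → ¬ P (p i) := by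
    intro i hi h0 hPi
    refine hmin (n - i) (by omega) ⟨fun l => p (l + i), by simpa using hPi, ?_, ?_, ?_⟩
    · have h2 : n - i + i = n := by omega
      simpa [h2] using hQn
    · intro l hl; exact hpC _ (by omega)
    · intro l hl
      have h3 : l + 1 + i = l + i + 1 := by omega
      simpa [h3] using hadj (l + i) (by omega)
  have hQi : ∀ i < n, ¬ Q (p i) := fun i hi hQi =>
    hmin i hi ⟨p, hP0, hQi, fun l hl => hpC l (by omega), fun l hl => hadj l (by omega)⟩
  refine ⟨n, p, ⟨?_, ?_⟩, hpC, hP0, hQn, hPi, hQi⟩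
  · intro i j hij hj
    constructor
    · intro h
      by_contra hne
      obtain ⟨k, rfl⟩ := Nat.exists_eq_add_of_lt hij
      obtain ⟨k, rfl⟩ : ∃ k', k = k' + 1 := ⟨k - 1, by omega⟩
      refine shortcut i (k + 1) (by omega) (by omega) ?_
      convert h using 2
      omega
    · rintro rfl
      exact hadj i (by omega)
  · intro i j hij hj h
    -- A repeated vertex is a chord to the successor of `p j`, or, if `j = n`, an earlier vertex
    -- satisfying `Q`.
    rcases Nat.lt_or_ge j n with hjn | hjn
    · have := hadj j hjn
      rw [← h] at this
      refine shortcut i (j - i) (by omega) (by omega) ?_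
      convert this using 2
      omega
    · obtain rfl : j = n := by omega
      exact hQi i hij (h ▸ hQn)

lemma IsInducedPath.isConnSet_image {p : ℕ → V} {n : ℕ} (hp : G.IsInducedPath p n) (i k : ℕ)
    (h : i + k ≤ n) : G.IsConnSet (p '' Set.Icc i (i + k)) := by
  induction k with
  | zero => simpa using isConnSet_singleton (p i)
  | succ k ih =>
    have : p '' Set.Icc i (i + (k + 1)) = insert (p (i + k + 1)) (p '' Set.Icc i (i + k)) := by
      rw [← Set.image_insert_eq]
      congr 1
      ext x
      simp only [Set.mem_Icc, Set.mem_insert_iff]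
      omega
    rw [this]
    refine (ih (by omega)).insert ⟨p (i + k), ⟨i + k, by simp, rfl⟩, ?_⟩
    exact ((hp.adj_iff (i + k) (i + k + 1) (by omega) (by omega)).2 rfl).symm

/-! ### Holes and caps. -/

/-- An induced cycle from a sequence of its vertices. -/
lemma exists_hole (q : ℕ → V) (m : ℕ)
    (hadj : ∀ i j, i < j → j < m → (G.Adj (q i) (q j) ↔ j = i + 1 ∨ (i = 0 ∧ j = m - 1)))
    (hne : ∀ i j, i < j → j < m → q i ≠ q j) :
    ∃ e : cycleGraph m ↪g G, ∀ i : Fin m, e i = q i := by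
  have key : ∀ i j : Fin m, i.1 < j.1 →
      ((cycleGraph m).Adj i j ↔ j.1 = i.1 + 1 ∨ (i.1 = 0 ∧ j.1 = m - 1)) := by
    rintro ⟨i, hi⟩ ⟨j, hj⟩ hij
    simp only at hij
    rw [cycleGraph_adj', Fin.sub_def, Fin.sub_def]
    simp only
    rw [show m - j + i = m - (j - i) by omega, Nat.mod_eq_of_lt (by omega : m - (j - i) < m),
      show m - i + j = (j - i) + m by omega, Nat.add_mod_right,
      Nat.mod_eq_of_lt (by omega : j - i < m)]
    omega
  refine ⟨⟨⟨fun i => q i, ?_⟩, ?_⟩, fun i => rfl⟩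
  · intro i j hij
    rcases lt_trichotomy i.1 j.1 with h | h | h
    · exact absurd hij (hne _ _ h j.2)
    · exact Fin.ext h
    · exact absurd hij.symm (hne _ _ h i.2)
  · intro i j
    change G.Adj (q i) (q j) ↔ _
    rcases lt_trichotomy i.1 j.1 with h | h | h
    · rw [hadj _ _ h j.2, key _ _ h]
    · obtain rfl : i = j := Fin.ext h
      simp
    · rw [G.adj_comm, (cycleGraph m).adj_comm, hadj _ _ h i.2, key _ _ h]

/-- There is no induced four-cycle. -/
lemma EvenHoleFree.adj_or_adj (hG : G.EvenHoleFree) {a b c d : V} (hab : G.Adj a b)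
    (hbc : G.Adj b c) (hcd : G.Adj c d) (hda : G.Adj d a) (hac : a ≠ c) (hbd : b ≠ d) :
    G.Adj a c ∨ G.Adj b d := by
  by_contra! h
  let q : ℕ → V := fun i => match i with
    | 0 => a
    | 1 => b
    | 2 => c
    | _ => d
  obtain ⟨e, -⟩ := exists_hole (G := G) q 4 (by
      intro i j hij hj
      interval_cases j <;> interval_cases i <;> simp [q, hab, hbc, hcd, hda.symm, h.1, h.2]) (by
      intro i j hij hj
      interval_cases j <;> interval_cases i <;>
        simp [q, hab.ne, hbc.ne, hcd.ne, hda.ne.symm, hac, hbd])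
  exact hG 4 le_rfl (by decide) ⟨e⟩

/-- A vertex `w` completing an edge `ab` to a triangle cannot be anticomplete to a connected set
through which `ab` extends to a hole. -/
lemma CapFree.not_cap (hG : G.CapFree) {C : Set V} (hC : G.IsConnSet C) {a b w : V}
    (haC : a ∉ C) (hbC : b ∉ C) (hwC : w ∉ C) (hab : G.Adj a b) (ha : G.Touches a C)
    (hb : G.Touches b C) (hcommon : ∀ c ∈ C, ¬ (G.Adj a c ∧ G.Adj b c)) (hwa : G.Adj w a)
    (hwb : G.Adj w b) (hw : ¬ G.Touches w C) : False := by
  obtain ⟨n, p, hp, hpC, hP0, hQn, hP, hQ⟩ := hC.exists_inducedPath (G.Adj a) (G.Adj b) ha hb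
  have hn : n ≠ 0 := by
    rintro rfl
    exact hcommon _ (hpC 0 le_rfl) ⟨hP0, hQn⟩
  have hPiff : ∀ i ≤ n, (G.Adj (p i) a ↔ i = 0) := fun i hi =>
    ⟨fun h => by by_contra h0; exact hP i hi (by omega) h.symm, fun h => h ▸ hP0.symm⟩
  have hQiff : ∀ i ≤ n, (G.Adj (p i) b ↔ i = n) := fun i hi =>
    ⟨fun h => by by_contra h0; exact hQ i (by omega) h.symm, fun h => h ▸ hQn.symm⟩
  have hpa : ∀ i ≤ n, p i ≠ a := fun i hi h => haC (h ▸ hpC i hi)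
  have hpb : ∀ i ≤ n, p i ≠ b := fun i hi h => hbC (h ▸ hpC i hi)
  -- The hole is `p 0, …, p n, b, a`; its length `n + 3` is at least four because `n ≠ 0`.
  let q : ℕ → V := fun i => if i ≤ n then p i else if i = n + 1 then b else a
  have q1 : ∀ i ≤ n, q i = p i := fun i hi => by simp [q, hi]
  have q2 : q (n + 1) = b := by simp [q]
  have q3 : q (n + 2) = a := by simp [q]
  obtain ⟨e, he⟩ := exists_hole (G := G) q (n + 3) (by
      intro i j hij hj
      rcases (by omega : j ≤ n ∨ j = n + 1 ∨ j = n + 2) with h | rfl | rfl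
      · rw [q1 i (by omega), q1 j h, hp.adj_iff i j hij h]; omega
      · rw [q1 i (by omega), q2, hQiff i (by omega)]; omega
      · rcases (by omega : i ≤ n ∨ i = n + 1) with h | rfl
        · rw [q1 i h, q3, hPiff i h]; omega
        · rw [q2, q3]; simp [hab.symm]) (by
      intro i j hij hj
      rcases (by omega : j ≤ n ∨ j = n + 1 ∨ j = n + 2) with h | rfl | rfl
      · rw [q1 i (by omega), q1 j h]; exact hp.ne i j hij h
      · rw [q1 i (by omega), q2]; exact hpb i (by omega)
      · rcases (by omega : i ≤ n ∨ i = n + 1) with h | rfl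
        · rw [q1 i h, q3]; exact hpa i h
        · rw [q2, q3]; exact hab.ne.symm)
  have hwq : ∀ i < n + 3, (G.Adj w (q i) ↔ i = n + 1 ∨ i = n + 2) := by
    intro i hi
    rcases (by omega : i ≤ n ∨ i = n + 1 ∨ i = n + 2) with h | rfl | rfl
    · rw [q1 i h]
      exact ⟨fun h' => absurd ⟨_, hpC i h, h'⟩ hw, fun h' => by omega⟩
    · simpa [q2] using hwb
    · simpa [q3] using hwa
  refine hG ⟨n + 3, by omega, e, w, ?_, ⟨n + 1, by omega⟩, ⟨n + 2, by omega⟩, ?_, ?_⟩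
  · rintro ⟨i, hi⟩
    rw [he] at hi
    rcases (by omega : i.1 ≤ n ∨ i.1 = n + 1 ∨ i.1 = n + 2) with h | h | h
    · rw [q1 _ h] at hi; exact hwC (hi ▸ hpC _ h)
    · rw [h, q2] at hi; exact hwb.ne hi.symm
    · rw [h, q3] at hi; exact hwa.ne hi.symm
  · rw [← e.map_adj_iff, he, he]
    simpa [q2, q3] using hab.symm
  · intro k
    rw [he, hwq k k.2]
    simp [Fin.ext_iff]

/-! ### Cores and minimal links. -/

/-- The subgraph induced by `F` has no clique cutset, phrased in terms of vertex sets: the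
boundary of a set `A` not dominating `F` contains two nonadjacent vertices. -/
def NoCliqueSep (G : SimpleGraph V) (F : Set V) : Prop :=
  ∀ A ⊆ F, A.Nonempty → (∃ b ∈ F, b ∉ A ∧ ¬ G.Touches b A) →
    ∃ x ∈ F, ∃ y ∈ F, x ∉ A ∧ y ∉ A ∧ G.Touches x A ∧ G.Touches y A ∧ x ≠ y ∧ ¬ G.Adj x y

/-- `F` induces a triangle-free graph. -/
def TriangleFreeOn (G : SimpleGraph V) (F : Set V) : Prop :=
  ∀ a ∈ F, ∀ b ∈ F, ∀ c ∈ F, G.Adj a b → G.Adj b c → ¬ G.Adj a c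

/-- `F` induces a noncomplete triangle-free graph without clique cutset. -/
structure IsCore (G : SimpleGraph V) (F : Set V) : Prop where
  triangleFree : G.TriangleFreeOn F
  noCliqueSep : G.NoCliqueSep F
  exists_not_adj : ∃ x ∈ F, ∃ y ∈ F, x ≠ y ∧ ¬ G.Adj x y

/-- `D` is connected and attaches to two nonadjacent vertices of `F`. -/
def IsLink (G : SimpleGraph V) (F D : Set V) : Prop :=
  G.IsConnSet D ∧ ∃ x ∈ F, ∃ y ∈ F, x ≠ y ∧ ¬ G.Adj x y ∧ G.Touches x D ∧ G.Touches y D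

lemma isLink_nonempty {F D : Set V} (h : G.IsLink F D) : D.Nonempty :=
  let ⟨_, _, _, _, _, _, _, ⟨d, hd, _⟩, _⟩ := h
  ⟨d, hd⟩

/-- No clique separates a part of a minimal link from the rest of the graph. -/
lemma not_separates_of_minimal_link {F D Z S : Set V} (hFD : Disjoint F D)
    (hD : Minimal (G.IsLink F) D) (hZD : Z ⊆ D) (hZ : Z.Nonempty) (hS : G.IsClique S)
    (hSZ : Disjoint S Z) (hN : ∀ v ∈ F ∪ D, v ∉ Z → G.Touches v Z → v ∈ S) : False := by
  obtain ⟨hconn, x, hx, y, hy, hxy, hnadj, hxD, hyD⟩ := hD.prop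
  have hFZ : ∀ v ∈ F, v ∉ Z := fun v hv hvZ => Set.disjoint_left.1 hFD hv (hZD hvZ)
  -- If `S` missed `D`, then `Z` would be all of `D`, and both `x` and `y` would lie in the clique
  -- `S`.
  have hZne : ∃ s ∈ S, s ∈ D := by
    by_contra! hcon
    have hDZ : D ⊆ Z := hconn Z hZD hZ (fun a ha b hb hab => by
      by_contra hbZ
      exact hcon b (hN b (Or.inr hb) hbZ ⟨a, ha, hab.symm⟩) hb)
    exact hnadj (hS (hN x (Or.inl hx) (hFZ x hx) (hxD.mono hDZ))
      (hN y (Or.inl hy) (hFZ y hy) (hyD.mono hDZ)) hxy)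
  obtain ⟨s, hsS, hsD⟩ := hZne
  have hsZ : s ∉ Z := Set.disjoint_left.1 hSZ hsS
  have htouch : ∀ v ∈ F, G.Touches v D → G.Touches v (D \ Z) := by
    rintro v hv ⟨d, hd, hvd⟩
    by_cases hdZ : d ∈ Z
    · refine ⟨s, ⟨hsD, hsZ⟩, hS (hN v (Or.inl hv) (hFZ v hv) ⟨d, hdZ, hvd⟩) hsS ?_⟩
      rintro rfl
      exact Set.disjoint_left.1 hFD hv hsD
    · exact ⟨d, ⟨hd, hdZ⟩, hvd⟩
  -- Deleting `Z` keeps `D` connected, since a detour through `Z` can be replaced by an edge of the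
  -- clique `S`. So `D \ Z` is a smaller link.
  have hconn' : G.IsConnSet (D \ Z) := by
    intro A hA hne hcl
    by_cases hAS : ∃ t ∈ A, t ∈ S
    · obtain ⟨t, htA, htS⟩ := hAS
      have hSA : ∀ u ∈ S, u ∈ D → u ∈ A := by
        intro u hu huD
        by_cases htu : t = u
        · exact htu ▸ htA
        · exact hcl t htA u ⟨huD, Set.disjoint_left.1 hSZ hu⟩ (hS htS hu htu)
      have hall : D ⊆ A ∪ Z := by
        refine hconn (A ∪ Z) (Set.union_subset (fun a ha => (hA ha).1) hZD)
          (hne.mono Set.subset_union_left) ?_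
        rintro a (ha | ha) b hb hab
        · by_cases hbZ : b ∈ Z
          · exact Or.inr hbZ
          · exact Or.inl (hcl a ha b ⟨hb, hbZ⟩ hab)
        · by_cases hbZ : b ∈ Z
          · exact Or.inr hbZ
          · exact Or.inl (hSA b (hN b (Or.inr hb) hbZ ⟨a, ha, hab.symm⟩) hb)
      exact fun v hv => (hall hv.1).resolve_right hv.2
    · have hall : D ⊆ A := by
        refine hconn A (fun a ha => (hA ha).1) hne (fun a ha b hb hab => ?_)
        by_cases hbZ : b ∈ Z
        · exact absurd ⟨a, ha, hN a (Or.inr (hA ha).1) (hA ha).2 ⟨b, hbZ, hab⟩⟩ hAS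
        · exact hcl a ha b ⟨hb, hbZ⟩ hab
      exact fun v hv => hall hv.1
  have hlink : G.IsLink F (D \ Z) :=
    ⟨hconn', x, hx, y, hy, hxy, hnadj, htouch x hx hxD, htouch y hy hyD⟩
  obtain ⟨z, hz⟩ := hZ
  exact (hD.le_of_le hlink Set.sdiff_subset (hZD hz)).2 hz

/-- Adding a minimal link creates no clique cutset, provided cliques do not separate `F` in the
enlarged graph. -/
lemma noCliqueSep_union {F D : Set V} (hFD : Disjoint F D) (hD : Minimal (G.IsLink F) D)
    (hF : ∀ A ⊆ F ∪ D, G.IsClique {v | v ∈ F ∪ D ∧ v ∉ A ∧ G.Touches v A} →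
      (∃ a ∈ F, a ∈ A) → (∃ b ∈ F, b ∉ A ∧ ¬ G.Touches b A) → False) :
    G.NoCliqueSep (F ∪ D) := by
  intro A hA hne ⟨b, hb, hbA, hbt⟩
  by_contra! hcon
  have hS : G.IsClique {v | v ∈ F ∪ D ∧ v ∉ A ∧ G.Touches v A} := by
    rintro x ⟨hx, hxA, hxt⟩ y ⟨hy, hyA, hyt⟩ hxy
    exact hcon x hx y hy hxA hyA hxt hyt hxy
  by_cases h1 : ∃ a ∈ F, a ∈ A
  · by_cases h2 : ∃ b ∈ F, b ∉ A ∧ ¬ G.Touches b A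
    · exact hF A hA hS h1 h2
    · push Not at h2
      -- Here `F` lies in `A` and its boundary, so the far side of the separation lies in `D`; in
      -- the remaining case `A` itself does.
      refine not_separates_of_minimal_link (Z := {v | v ∈ F ∪ D ∧ v ∉ A ∧ ¬ G.Touches v A})
        hFD hD ?_ ⟨b, hb, hbA, hbt⟩ hS ?_ ?_
      · rintro v ⟨hv, hvA, hvt⟩
        exact hv.resolve_left fun hvF => hvt (h2 v hvF hvA)
      · exact Set.disjoint_left.2 fun v hv hv' => hv'.2.2 hv.2.2
      · rintro v hv hvZ ⟨z, ⟨hz, hzA, hzt⟩, hvz⟩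
        have hvA : v ∉ A := fun h => hzt ⟨v, h, hvz.symm⟩
        exact ⟨hv, hvA, by_contra fun h => hvZ ⟨hv, hvA, h⟩⟩
  · push Not at h1
    refine not_separates_of_minimal_link hFD hD (fun a ha => (hA ha).resolve_left
      fun haF => h1 a haF ha) hne hS ?_ fun v hv hvA hvt => ⟨hv, hvA, hvt⟩
    exact Set.disjoint_left.2 fun v hv hv' => hv.2.1 hv'

/-- The boundary of `A ∩ F` within `F` is part of the boundary of `A`, and it already contains two
nonadjacent vertices. -/
lemma NoCliqueSep.union {F D : Set V} (hF : G.NoCliqueSep F) (hFD : Disjoint F D)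
    (hD : Minimal (G.IsLink F) D) : G.NoCliqueSep (F ∪ D) := by
  refine noCliqueSep_union hFD hD ?_
  rintro A - hS ⟨a, haF, haA⟩ ⟨b, hbF, hbA, hbt⟩
  obtain ⟨x, hx, y, hy, hxA, hyA, hxt, hyt, hxy, hn⟩ := hF (A ∩ F) Set.inter_subset_right
    ⟨a, haA, haF⟩ ⟨b, hbF, fun h => hbA h.1, fun h => hbt (h.mono Set.inter_subset_left)⟩
  have hS' : ∀ z ∈ F, z ∉ A ∩ F → G.Touches z (A ∩ F) →
      z ∈ {v | v ∈ F ∪ D ∧ v ∉ A ∧ G.Touches v A} := fun z hz hzA hzt =>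
    ⟨Or.inl hz, fun h => hzA ⟨h, hz⟩, hzt.mono Set.inter_subset_left⟩
  exact hn (hS (hS' x hx hxA hxt) (hS' y hy hyA hyt) hxy)

/-- A minimal link is an induced path. -/
lemma exists_inducedPath_of_minimal_link {F D : Set V} (hD : Minimal (G.IsLink F) D) :
    ∃ x ∈ F, ∃ y ∈ F, x ≠ y ∧ ¬ G.Adj x y ∧ ∃ (n : ℕ) (p : ℕ → V), G.IsInducedPath p n ∧
      D = p '' Set.Icc 0 n ∧ G.Adj x (p 0) ∧ G.Adj y (p n) ∧
      (∀ i ≤ n, 0 < i → ¬ G.Adj x (p i)) ∧ ∀ i < n, ¬ G.Adj y (p i) := by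
  obtain ⟨hconn, x, hx, y, hy, hxy, hnadj, hxD, hyD⟩ := hD.prop
  obtain ⟨n, p, hp, hpD, h0, hn, h0', hn'⟩ := hconn.exists_inducedPath (G.Adj x) (G.Adj y) hxD hyD
  refine ⟨x, hx, y, hy, hxy, hnadj, n, p, hp, ?_, h0, hn, h0', hn'⟩
  have hsub : p '' Set.Icc 0 n ⊆ D := by
    rintro _ ⟨i, hi, rfl⟩
    exact hpD i hi.2
  have hlink : G.IsLink F (p '' Set.Icc 0 n) :=
    ⟨by simpa using hp.isConnSet_image 0 n (by omega), x, hx, y, hy, hxy, hnadj,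
      ⟨p 0, ⟨0, by simp, rfl⟩, h0⟩, ⟨p n, ⟨n, by simp, rfl⟩, hn⟩⟩
  exact (hD.le_of_le hlink hsub).antisymm hsub

/-- A new triangle has one path vertex, excluded by `h1`, or two consecutive ones, excluded by `h2`;
an induced path contains no three mutually adjacent vertices. -/
lemma TriangleFreeOn.union_path {F : Set V} (hF : G.TriangleFreeOn F) {p : ℕ → V} {n : ℕ}
    (hp : G.IsInducedPath p n)
    (h1 : ∀ i ≤ n, ∀ a ∈ F, ∀ b ∈ F, G.Adj a b → G.Adj a (p i) → ¬ G.Adj b (p i))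
    (h2 : ∀ i < n, ∀ a ∈ F, G.Adj a (p i) → ¬ G.Adj a (p (i + 1))) :
    G.TriangleFreeOn (F ∪ p '' Set.Icc 0 n) := by
  have hstep : ∀ i ≤ n, ∀ j ≤ n, G.Adj (p i) (p j) → j = i + 1 ∨ i = j + 1 := by
    intro i hi j hj hij
    rcases lt_trichotomy i j with h | rfl | h
    · exact Or.inl ((hp.adj_iff i j h hj).1 hij)
    · exact absurd hij (G.irrefl)
    · exact Or.inr ((hp.adj_iff j i h hi).1 hij.symm)
  have h2' : ∀ i ≤ n, ∀ j ≤ n, ∀ a ∈ F, G.Adj (p i) (p j) → G.Adj a (p i) →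
      ¬ G.Adj a (p j) := by
    intro i hi j hj a ha hij hai haj
    rcases hstep i hi j hj hij with rfl | rfl
    · exact h2 i (by omega) a ha hai haj
    · exact h2 j (by omega) a ha haj hai
  rintro a (ha | ⟨i, ⟨-, hi⟩, rfl⟩) b (hb | ⟨j, ⟨-, hj⟩, rfl⟩) c (hc | ⟨k, ⟨-, hk⟩, rfl⟩) hab hbc hac
  · exact hF a ha b hb c hc hab hbc hac
  · exact h1 k hk a ha b hb hab hac hbc
  · exact h1 j hj a ha c hc hac hab hbc.symm
  · exact h2' j hj k hk a ha hbc hab hac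
  · exact h1 i hi b hb c hc hbc hab.symm hac.symm
  · exact h2' i hi k hk b hb hac hab.symm hbc
  · exact h2' i hi j hj c hc hab hac.symm hbc.symm
  · have := hstep i hi j hj hab
    have := hstep j hj k hk hbc
    have := hstep i hi k hk hac
    omega

lemma IsCore.isConnSet {F : Set V} (hF : G.IsCore F) : G.IsConnSet F := by
  intro A hA hne hcl
  by_contra hcon
  obtain ⟨b, hb, hbA⟩ := Set.not_subset.1 hcon
  obtain ⟨x, hx, -, -, hxA, -, ⟨a, ha, hxa⟩, -⟩ := hF.noCliqueSep A hA hne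
    ⟨b, hb, hbA, fun ⟨a, ha, hba⟩ => hbA (hcl a ha b hb hba.symm)⟩
  exact hxA (hcl a ha x hx hxa.symm)

/-- If `x` dominated `F`, the rest of `F` would be independent, and `x` alone would separate two
nonadjacent vertices. -/
lemma IsCore.exists_not_dominated {F : Set V} (hF : G.IsCore F) {x : V} (hx : x ∈ F) :
    ∃ b ∈ F, b ≠ x ∧ ¬ G.Adj x b := by
  by_contra! hcon
  obtain ⟨a, ha, b, hb, hab, hnadj⟩ := hF.exists_not_adj
  have hxa : x ≠ a := by
    rintro rfl
    exact hnadj (hcon b hb hab.symm)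
  obtain ⟨c, hc, d, hd, -, -, ⟨c', hc', hca⟩, ⟨d', hd', hda⟩, hcd, -⟩ :=
    hF.noCliqueSep {a} (by simpa using ha) (by simp)
      ⟨b, hb, hab.symm, fun ⟨_, h, h'⟩ => hnadj (by subst h; exact h'.symm)⟩
  rw [Set.mem_singleton_iff] at hc' hd'
  rw [hc'] at hca
  rw [hd'] at hda
  have key : ∀ c ∈ F, G.Adj c a → c = x := by
    intro c hc hca
    by_contra hcx
    exact hF.triangleFree x hx c hc a ha (hcon c hc hcx) hca (hcon a ha hxa.symm)
  exact hcd ((key c hc hca).trans (key d hd hda).symm)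

lemma IsCore.exists_neighbors {F : Set V} (hF : G.IsCore F) {x : V} (hx : x ∈ F) :
    ∃ y ∈ F, ∃ z ∈ F, G.Adj x y ∧ G.Adj x z ∧ y ≠ z ∧ ¬ G.Adj y z := by
  obtain ⟨b, hb, hbx, hxb⟩ := hF.exists_not_dominated hx
  obtain ⟨c, hc, d, hd, -, -, ⟨_, rfl, hca⟩, ⟨_, rfl, hda⟩, hcd, hn⟩ :=
    hF.noCliqueSep {x} (by simpa using hx) (by simp)
      ⟨b, hb, hbx, fun ⟨_, h, h'⟩ => hxb (by subst h; exact h'.symm)⟩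
  exact ⟨c, hc, d, hd, hca.symm, hda.symm, hcd, hn⟩

/-- `v` and `x` have the same closed neighbourhood in `F`. -/
def TwinOn (G : SimpleGraph V) (F : Set V) (v x : V) : Prop :=
  ∀ f ∈ F, (f = v ∨ G.Adj v f) ↔ (f = x ∨ G.Adj x f)

/-! ### Existence of a core, and vertices with two adjacent neighbours in a core. -/

/-- A noncomplete graph without clique cutset contains a hole, which is a core. -/
lemma NoCliqueSep.exists_isCore [Finite V] {T : Set V} (hT : G.NoCliqueSep T) {u v : V}
    (hu : u ∈ T) (hv : v ∈ T) (huv : u ≠ v) (hnadj : ¬ G.Adj u v) : ∃ F, G.IsCore F := by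
  -- The boundary of a component `C` of the nonneighbours of `u` lies in the neighbourhood of `u`.
  -- Two nonadjacent vertices `x`, `y` of it, joined through `C`, close a hole at `u`.
  obtain ⟨C, hCX, hvC, hCconn, hCcl⟩ := exists_component (G := G)
    {w | w ∈ T ∧ w ≠ u ∧ ¬ G.Adj u w} (c := v) ⟨hv, huv.symm, hnadj⟩
  have huC : ∀ c ∈ C, ¬ G.Adj u c := fun c hc => (hCX hc).2.2
  obtain ⟨x, hx, y, hy, hxC, hyC, hxt, hyt, hxy, hnxy⟩ := hT C (fun c hc => (hCX hc).1) ⟨v, hvC⟩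
    ⟨u, hu, fun h => (hCX h).2.1 rfl, fun ⟨c, hc, h⟩ => huC c hc h⟩
  have hadj : ∀ w ∈ T, w ∉ C → G.Touches w C → G.Adj u w := by
    rintro w hw hwC ⟨c, hc, hwc⟩
    by_contra h
    exact hwC (hCcl c hc w ⟨hw, fun h => huC c hc (h ▸ hwc), h⟩ hwc.symm)
  have hux := hadj x hx hxC hxt
  have huy := hadj y hy hyC hyt
  obtain ⟨D, hDC, hD⟩ := exists_minimal_le_of_wellFoundedLT (G.IsLink {x, u, y}) C
    ⟨hCconn, x, by simp, y, by simp, hxy, hnxy, hxt, hyt⟩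
  have hFD : Disjoint {x, u, y} D := by
    refine Set.disjoint_left.2 ?_
    rintro w (rfl | rfl | rfl) hw
    · exact hxC (hDC hw)
    · exact (hCX (hDC hw)).2.1 rfl
    · exact hyC (hDC hw)
  refine ⟨{x, u, y} ∪ D, ?_, ?_, x, by simp, y, by simp, hxy, hnxy⟩
  · obtain ⟨x', hx', y', hy', hxy', hn', n, p, hp, rfl, h0, hn, h0', hn''⟩ :=
      exists_inducedPath_of_minimal_link hD
    have hup : ∀ i ≤ n, ¬ G.Adj u (p i) := fun i hi => huC _ (hDC ⟨i, by simpa using hi, rfl⟩)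
    have hx'u : x' ≠ u := by rintro rfl; exact hup 0 (by omega) h0
    have hy'u : y' ≠ u := by rintro rfl; exact hup n le_rfl hn
    refine TriangleFreeOn.union_path ?_ hp ?_ ?_
    · rintro a (rfl | rfl | rfl) b (rfl | rfl | rfl) c (rfl | rfl | rfl) <;>
        simp_all [G.adj_comm]
    · rintro i hi a (rfl | rfl | rfl) b (rfl | rfl | rfl) hab hai hbi
      all_goals first
        | exact hup i hi hai
        | exact hup i hi hbi
        | exact hab.ne rfl
        | exact hnxy hab
        | exact hnxy hab.symm
    · intro i hi a ha hai hai'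
      have : a = x' ∨ a = u ∨ a = y' := by
        simp only [Set.mem_insert_iff, Set.mem_singleton_iff] at ha hx' hy'
        grind
      rcases this with rfl | rfl | rfl
      · exact h0' (i + 1) (by omega) (by omega) hai'
      · exact hup i (by omega) hai
      · exact hn'' i hi hai
  · refine noCliqueSep_union hFD hD ?_
    -- The path `x, u, y` is itself cut by `u`, so `NoCliqueSep.union` does not apply. Instead: `u`
    -- is in the boundary of `A` and has no neighbour in `D`, so the clique boundary misses `D`.
    -- Then `A` swallows `D`, and `b` touches it.
    rintro A hA hS ⟨a, haF, haA⟩ ⟨b, hbF, hbA, hbt⟩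
    obtain ⟨hconn, -⟩ := hD.prop
    have hxD : G.Touches x D ∧ G.Touches y D := by
      obtain ⟨-, x', hx', y', hy', hxy', hn', h1, h2⟩ := hD.prop
      have huD : ¬ G.Touches u D := fun ⟨d, hd, h⟩ => huC d (hDC hd) h
      rcases hx' with rfl | rfl | rfl <;> rcases hy' with rfl | rfl | rfl <;>
        first | exact ⟨h1, h2⟩ | exact ⟨h2, h1⟩ | exact absurd h1 huD | exact absurd h2 huD |
          exact absurd rfl hxy'
    have huA : u ∉ A := by
      intro h
      rcases hbF with rfl | rfl | rfl
      · exact hbt ⟨u, h, hux.symm⟩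
      · exact hbA h
      · exact hbt ⟨u, h, huy.symm⟩
    have huS : G.Touches u A := by
      rcases haF with rfl | rfl | rfl
      · exact ⟨_, haA, hux⟩
      · exact absurd haA huA
      · exact ⟨_, haA, huy⟩
    have hDA : ∀ d ∈ D, G.Touches d A → d ∈ A := by
      intro d hd hdt
      by_contra hdA
      refine huC d (hDC hd) (hS ⟨Or.inl (by simp), huA, huS⟩ ⟨Or.inr hd, hdA, hdt⟩ ?_)
      rintro rfl
      exact (hCX (hDC hd)).2.1 rfl
    have haD : G.Touches a D := by
      rcases haF with rfl | rfl | rfl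
      · exact hxD.1
      · exact absurd haA huA
      · exact hxD.2
    have hbD : G.Touches b D := by
      rcases hbF with rfl | rfl | rfl
      · exact hxD.1
      · exact absurd huS hbt
      · exact hxD.2
    obtain ⟨d, hd, had⟩ := haD
    obtain ⟨e, he, hbe⟩ := hbD
    have := hconn (A ∩ D) Set.inter_subset_right ⟨d, hDA d hd ⟨a, haA, had.symm⟩, hd⟩
      (fun s hs t ht hst => ⟨hDA t ht ⟨s, hs.1, hst.symm⟩, ht⟩) he
    exact hbt ⟨e, this.1, hbe⟩

/-- A vertex with two adjacent neighbours in a core `F` is complete to `F` or a twin of a vertex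
of `F`. -/
lemma IsCore.complete_or_twin {F : Set V} (hF : G.IsCore F) (hhole : G.EvenHoleFree)
    (hcap : G.CapFree) {r a b : V} (hr : r ∉ F) (ha : a ∈ F) (hb : b ∈ F) (hab : G.Adj a b)
    (hra : G.Adj r a) (hrb : G.Adj r b) :
    (∀ f ∈ F, G.Adj r f) ∨ ∃ n ∈ F, G.TwinOn F r n := by
  refine or_iff_not_imp_left.2 fun hnot => ?_
  obtain ⟨f₀, hf₀, hrf₀⟩ : ∃ f ∈ F, ¬ G.Adj r f := by simpa using hnot
  /- Structure of the attachments of a component of the nonneighbours of `r`. -/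
  have comp : ∀ c ∈ F, ¬ G.Adj r c → ∃ D ⊆ F, c ∈ D ∧ G.IsConnSet D ∧ (∀ d ∈ D, ¬ G.Adj r d) ∧
      (∀ v ∈ F, v ∉ D → G.Touches v D → G.Adj r v) ∧
      (∀ d ∈ F, ∀ m ∈ F, G.Adj r d → G.Adj r m → G.Touches d D → G.Adj d m →
        ¬ G.Touches m D) ∧
      ∀ d ∈ F, ∀ m ∈ F, G.Adj r d → G.Adj r m → G.Touches d D → G.Adj d m →
        ∀ e ∈ F, G.Adj r e → G.Touches e D →
          ∀ m' ∈ F, G.Adj r m' → (G.Adj e m' ↔ m' = m) := by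
    intro c hc hrc
    obtain ⟨D, hDX, hcD, hD, hDcl⟩ := exists_component (G := G) {w | w ∈ F ∧ ¬ G.Adj r w}
      (c := c) ⟨hc, hrc⟩
    have hDF : D ⊆ F := fun d hd => (hDX hd).1
    have hDr : ∀ d ∈ D, ¬ G.Adj r d := fun d hd => (hDX hd).2
    have hrD : r ∉ D := fun h => hr (hDF h)
    have hrt : ¬ G.Touches r D := fun ⟨d, hd, h⟩ => hDr d hd h
    have hbd : ∀ v ∈ F, v ∉ D → G.Touches v D → G.Adj r v := by
      rintro v hv hvD ⟨d, hd, hvd⟩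
      by_contra h
      exact hvD (hDcl d hd v ⟨hv, h⟩ hvd.symm)
    have hind : ∀ d ∈ F, ∀ m ∈ F, G.Adj r d → G.Adj r m → G.Touches d D → G.Adj d m →
        ¬ G.Touches m D := by
      intro d hd m hm hrd hrm hdt hdm hmt
      exact hcap.not_cap hD (fun h => hDr d h hrd) (fun h => hDr m h hrm) hrD hdm hdt hmt
        (fun e he h => hF.triangleFree d hd m hm e (hDF he) hdm h.2 h.1) hrd hrm hrt
    have hcompl : ∀ d ∈ F, ∀ m ∈ F, G.Adj r d → G.Adj r m → G.Touches d D → G.Adj d m →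
        ∀ e ∈ F, G.Adj r e → G.Touches e D → G.Adj e m := by
      intro d hd m hm hrd hrm hdt hdm e he hre het
      by_contra hem
      have hmt := hind d hd m hm hrd hrm hdt hdm
      have hde : ¬ G.Adj d e := fun h => hind d hd e he hrd hre hdt h het
      have hmD : m ∉ D := fun h => hDr m h hrm
      have hdD : d ∉ D := fun h => hDr d h hrd
      have hme : m ≠ e := by rintro rfl; exact hmt het
      -- The hole runs through `d`, `r`, `e` and back inside `D`; on it `m` sees only `d` and `r`.
      refine hcap.not_cap (C := insert e D) (a := d) (b := r) (w := m)
        (hD.insert het) ?_ ?_ ?_ hrd.symm (hdt.mono (Set.subset_insert _ _)) ⟨e, by simp, hre⟩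
        ?_ hdm.symm hrm.symm ?_
      · rintro (rfl | h)
        · exact hem hdm
        · exact hdD h
      · rintro (rfl | h)
        · exact G.irrefl hre
        · exact hrD h
      · rintro (rfl | h)
        · exact hme rfl
        · exact hmD h
      · rintro x (rfl | hx) ⟨h1, h2⟩
        · exact hde h1
        · exact hDr x hx h2
      · rintro ⟨x, rfl | hx, h⟩
        · exact hem h.symm
        · exact hmt ⟨x, hx, h⟩
    refine ⟨D, hDF, hcD, hD, hDr, hbd, hind, ?_⟩
    intro d hd m hm hrd hrm hdt hdm e he hre het m' hm' hrm'
    refine ⟨fun hem' => ?_, fun h => h ▸ hcompl d hd m hm hrd hrm hdt hdm e he hre het⟩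
    by_contra hne
    -- Two nonadjacent attachments `x`, `y` of `D` are both complete to `m` and `m'`, which gives a
    -- four-cycle `x m y m'`.
    have hbnd : ∃ w ∈ F, w ∉ D ∧ ¬ G.Touches w D :=
      ⟨m, hm, fun h => hDr m h hrm, hind d hd m hm hrd hrm hdt hdm⟩
    obtain ⟨x, hx, y, hy, hxD, hyD, hxt, hyt, hxy, hnxy⟩ := hF.noCliqueSep D hDF ⟨c, hcD⟩ hbnd
    have hrx := hbd x hx hxD hxt
    have hry := hbd y hy hyD hyt
    have h1 := hcompl d hd m hm hrd hrm hdt hdm x hx hrx hxt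
    have h2 := hcompl d hd m hm hrd hrm hdt hdm y hy hry hyt
    have h3 := hcompl e he m' hm' hre hrm' het hem' x hx hrx hxt
    have h4 := hcompl e he m' hm' hre hrm' het hem' y hy hry hyt
    rcases hhole.adj_or_adj h1 h2.symm h4 h3.symm hxy (Ne.symm hne) with h | h
    · exact hnxy h
    · exact hF.triangleFree x hx m hm m' hm' h1 h h3
  /- A nonisolated vertex of the neighbourhood of `r` attached to a nonneighbour. -/
  obtain ⟨d, hd, hrd, n, hn, hrn, hdn, y, hy, hry, hdy⟩ : ∃ d ∈ F, G.Adj r d ∧ ∃ n ∈ F,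
      G.Adj r n ∧ G.Adj d n ∧ ∃ y ∈ F, ¬ G.Adj r y ∧ G.Adj d y := by
    -- Otherwise the nonisolated vertices of the neighbourhood of `r` in `F` form a closed part of
    -- the connected set `F`, hence all of it.
    by_contra! hcon
    have := hF.isConnSet {d | d ∈ F ∧ G.Adj r d ∧ ∃ n ∈ F, G.Adj r n ∧ G.Adj d n}
      (fun d hd => hd.1) ⟨a, ha, hra, b, hb, hrb, hab⟩ (by
        rintro d ⟨hd, hrd, n, hn, hrn, hdn⟩ e he hde
        by_cases hre : G.Adj r e
        · exact ⟨he, hre, d, hd, hrd, hde.symm⟩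
        · exact absurd hde (hcon d hd hrd n hn hrn hdn e he hre))
    exact hrf₀ (this hf₀).2.1
  let L : Set V := {d | d ∈ F ∧ G.Adj r d ∧ ∀ m ∈ F, G.Adj r m → (G.Adj d m ↔ m = n)}
  have hdL : d ∈ L := by
    obtain ⟨D, -, hyD, -, -, -, -, hD⟩ := comp y hy hry
    exact ⟨hd, hrd, hD d hd n hn hrd hrn ⟨y, hyD, hdy⟩ hdn d hd hrd ⟨y, hyD, hdy⟩⟩
  have hLn : ∀ l ∈ L, G.Adj l n := fun l hl => (hl.2.2 n hn hrn).2 rfl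
  have hstep : ∀ l ∈ L, ∀ D ⊆ F, (∀ v ∈ F, v ∉ D → G.Touches v D → G.Adj r v) →
      (∀ d ∈ F, ∀ m ∈ F, G.Adj r d → G.Adj r m → G.Touches d D → G.Adj d m →
        ¬ G.Touches m D) →
      (∀ d ∈ F, ∀ m ∈ F, G.Adj r d → G.Adj r m → G.Touches d D → G.Adj d m →
        ∀ e ∈ F, G.Adj r e → G.Touches e D →
          ∀ m' ∈ F, G.Adj r m' → (G.Adj e m' ↔ m' = m)) → G.Touches l D →
      (∀ v ∈ F, v ∉ D → G.Touches v D → v ∈ L) ∧ ¬ G.Touches n D := by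
    intro l hl D hDF h1 h2 h3 hlt
    refine ⟨fun v hv hvD hvt => ?_, h2 l hl.1 n hn hl.2.1 hrn hlt (hLn l hl)⟩
    have hrv := h1 v hv hvD hvt
    exact ⟨hv, hrv, h3 l hl.1 n hn hl.2.1 hrn hlt (hLn l hl) v hv hrv hvt⟩
  /- The leaves at `n` and the components attached to them fill `F` up to `n`. -/
  let Y : Set V := {w | w ∈ L ∨ ∃ l ∈ L, ∃ D ⊆ F, w ∈ D ∧ (∀ d ∈ D, ¬ G.Adj r d) ∧
      (∀ v ∈ F, v ∉ D → G.Touches v D → v ∈ L) ∧ ¬ G.Touches n D}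
  have hYF : Y ⊆ F := by
    rintro w (hw | ⟨-, -, D, hD, hwD, -⟩)
    · exact hw.1
    · exact hD hwD
  have hYcl : ∀ w ∈ Y, ∀ v ∈ F, G.Adj w v → v ≠ n → v ∈ Y := by
    rintro w (hw | ⟨l, hl, D, hD, hwD, hDr, h1, h2⟩) v hv hwv hvn
    · by_cases hrv : G.Adj r v
      · exact absurd ((hw.2.2 v hv hrv).1 hwv) hvn
      · obtain ⟨D, hDF, hvD, -, hDr, h1, h2, h3⟩ := comp v hv hrv
        exact Or.inr ⟨w, hw, D, hDF, hvD, hDr, hstep w hw D hDF h1 h2 h3 ⟨v, hvD, hwv⟩⟩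
    · by_cases hvD : v ∈ D
      · exact Or.inr ⟨l, hl, D, hD, hvD, hDr, h1, h2⟩
      · exact Or.inl (h1 v hv hvD ⟨w, hwD, hwv.symm⟩)
  have hnY : n ∉ Y := by
    rintro (h | ⟨l, hl, D, hD, hwD, hDr, h1, h2⟩)
    · exact G.irrefl (hLn n h)
    · exact hDr n hwD hrn
  -- Only `n` can lie in the boundary of `Y`, and a single vertex does not separate `F`.
  have hall : ∀ f ∈ F, f ≠ n → f ∈ Y := by
    by_contra! hcon
    obtain ⟨f, hf, hfn, hfY⟩ := hcon
    have key : ∀ x ∈ F, x ∉ Y → G.Touches x Y → x = n := by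
      rintro x hx hxY ⟨w, hw, hxw⟩
      by_contra hxn
      exact hxY (hYcl w hw x hx hxw.symm hxn)
    obtain ⟨x, hx, z, hz, hxY, hzY, hxt, hzt, hxz, -⟩ := hF.noCliqueSep Y hYF ⟨d, Or.inl hdL⟩
      ⟨f, hf, hfY, fun h => hfn (key f hf hfY h)⟩
    exact hxz ((key x hx hxY hxt).trans (key z hz hzY hzt).symm)
  refine ⟨n, hn, fun f hf => ?_⟩
  have hfr : f ≠ r := by rintro rfl; exact hr hf
  by_cases hfn : f = n
  · simp [hfn, hrn]
  · simp only [hfr, hfn, false_or]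
    rcases hall f hf hfn with h | ⟨l, hl, D, hD, hwD, hDr, h1, h2⟩
    · exact ⟨fun _ => (hLn f h).symm, fun _ => h.2.1⟩
    · exact ⟨fun h => absurd h (hDr f hwD), fun h => absurd ⟨f, hwD, h⟩ h2⟩

/-! ### Adjacency between twins and complete vertices. -/

lemma TwinOn.adj_of_adj {F : Set V} {v x f : V} (h : G.TwinOn F v x) (hf : f ∈ F)
    (hxf : G.Adj x f) (hvf : f ≠ v) : G.Adj v f :=
  ((h f hf).2 (Or.inr hxf)).resolve_left hvf

/-- Distinct twins in a triangle-free graph have no further neighbours, but every vertex of a core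
has two. -/
lemma IsCore.eq_of_twinOn {F : Set V} (hF : G.IsCore F) {v x : V} (hv : v ∈ F) (hx : x ∈ F)
    (h : G.TwinOn F v x) : v = x := by
  by_contra hne
  have hxv : G.Adj x v := ((h v hv).1 (Or.inl rfl)).resolve_left hne
  obtain ⟨y, hy, z, hz, hxy, hxz, hyz, hn⟩ := hF.exists_neighbors hx
  have key : ∀ y ∈ F, G.Adj x y → y = v := by
    intro y hy hxy
    by_contra hyv
    exact hF.triangleFree x hx y hy v hv hxy (h.adj_of_adj hy hxy hyv).symm hxv
  exact hyz ((key y hy hxy).trans (key z hz hxz).symm)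

/-- Vertices of a core adjacent to `x` are adjacent to its twins. -/
lemma IsCore.adj_twin {F : Set V} (hF : G.IsCore F) {v x f : V} (hx : x ∈ F) (hf : f ∈ F)
    (h : G.TwinOn F v x) (hxf : G.Adj x f) : G.Adj v f := by
  refine h.adj_of_adj hf hxf ?_
  rintro rfl
  exact hxf.ne (hF.eq_of_twinOn hf hx h).symm

lemma IsCore.adj_twin_iff {F : Set V} (hF : G.IsCore F) {v x f : V} (hx : x ∈ F) (hf : f ∈ F)
    (hfx : f ≠ x) (h : G.TwinOn F v x) : G.Adj v f ↔ G.Adj x f :=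
  ⟨fun hv => ((h f hf).1 (Or.inr hv)).resolve_left hfx, hF.adj_twin hx hf h⟩

lemma IsCore.twinOn_mem {F : Set V} (hF : G.IsCore F) {v x : V} (hx : x ∈ F)
    (h : G.TwinOn F v x) (hv : v ≠ x) : v ∉ F := fun hvF => hv (hF.eq_of_twinOn hvF hx h)

/-- Twins of the same vertex are adjacent. -/
lemma IsCore.adj_of_twinOn_same {F : Set V} (hF : G.IsCore F) (hhole : G.EvenHoleFree)
    {v w x : V} (hx : x ∈ F) (hv : G.TwinOn F v x) (hw : G.TwinOn F w x) (hne : v ≠ w) :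
    G.Adj v w := by
  obtain ⟨y, hy, z, hz, hxy, hxz, hyz, hn⟩ := hF.exists_neighbors hx
  exact (hhole.adj_or_adj (hF.adj_twin hx hy hv hxy) (hF.adj_twin hx hy hw hxy).symm
    (hF.adj_twin hx hz hw hxz) (hF.adj_twin hx hz hv hxz).symm hne hyz).resolve_right hn

/-- Vertices complete to a core are adjacent to all twins of its vertices. -/
lemma IsCore.adj_of_complete_of_twinOn {F : Set V} (hF : G.IsCore F) (hhole : G.EvenHoleFree)
    {u v x : V} (hx : x ∈ F) (hu : ∀ f ∈ F, G.Adj u f) (hv : G.TwinOn F v x) : G.Adj u v := by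
  obtain ⟨y, hy, z, hz, hxy, hxz, hyz, hn⟩ := hF.exists_neighbors hx
  refine (hhole.adj_or_adj (hu y hy) (hF.adj_twin hx hy hv hxy).symm
    (hF.adj_twin hx hz hv hxz) (hu z hz).symm ?_ hyz).resolve_right hn
  rintro rfl
  have hux : ∀ f ∈ F, f = x ∨ G.Adj x f := fun f hf => (hv f hf).1 (Or.inr (hu f hf))
  obtain ⟨b, hb, hbx, hxb⟩ := hF.exists_not_dominated hx
  exact (hux b hb).elim hbx hxb

lemma IsCore.adj_of_complete {F : Set V} (hF : G.IsCore F) (hhole : G.EvenHoleFree) {u v : V}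
    (hu : ∀ f ∈ F, G.Adj u f) (hv : ∀ f ∈ F, G.Adj v f) (huv : u ≠ v) : G.Adj u v := by
  obtain ⟨x, hx, y, hy, hxy, hn⟩ := hF.exists_not_adj
  exact (hhole.adj_or_adj (hu x hx) (hv x hx).symm (hv y hy) (hu y hy).symm huv hxy).resolve_right hn

/-- A component of the nonneighbours of `x` in a core, with two nonadjacent attachments. -/
lemma IsCore.exists_far_component {F : Set V} (hF : G.IsCore F) {x c : V} (hx : x ∈ F)
    (hc : c ∈ F) (hcx : c ≠ x) (hxc : ¬ G.Adj x c) :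
    ∃ D ⊆ F, c ∈ D ∧ G.IsConnSet D ∧ (∀ d ∈ D, d ≠ x ∧ ¬ G.Adj x d) ∧
      ∃ y ∈ F, ∃ z ∈ F, G.Touches y D ∧ G.Touches z D ∧ G.Adj x y ∧ G.Adj x z ∧ y ≠ z ∧
        ¬ G.Adj y z := by
  obtain ⟨D, hDX, hcD, hD, hDcl⟩ := exists_component (G := G)
    {w | w ∈ F ∧ w ≠ x ∧ ¬ G.Adj x w} (c := c) ⟨hc, hcx, hxc⟩
  have hxt : ¬ G.Touches x D := fun ⟨d, hd, h⟩ => (hDX hd).2.2 h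
  obtain ⟨y, hy, z, hz, hyD, hzD, hyt, hzt, hyz, hn⟩ := hF.noCliqueSep D (fun d hd => (hDX hd).1)
    ⟨c, hcD⟩ ⟨x, hx, fun h => (hDX h).2.1 rfl, hxt⟩
  have hadj : ∀ w ∈ F, w ∉ D → G.Touches w D → G.Adj x w := by
    rintro w hw hwD hwt
    by_contra h
    have hwx : w ≠ x := by rintro rfl; exact hxt hwt
    obtain ⟨d, hd, hwd⟩ := hwt
    exact hwD (hDcl d hd w ⟨hw, hwx, h⟩ hwd.symm)
  exact ⟨D, fun d hd => (hDX hd).1, hcD, hD, fun d hd => (hDX hd).2, y, hy, z, hz, hyt, hzt,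
    hadj y hy hyD hyt, hadj z hz hzD hzt, hyz, hn⟩

/-- If `v` and `w` were nonadjacent, a hole through `z`, `y`, `v` and a component of the
nonneighbours of `y` would form a cap with `w`, which sees only `y` and `z` on it. -/
lemma IsCore.adj_of_twinOn_of_adj {F : Set V} (hF : G.IsCore F) (hcap : G.CapFree)
    {v w x y : V} (hx : x ∈ F) (hy : y ∈ F) (hv : G.TwinOn F v x) (hw : G.TwinOn F w y)
    (hxy : G.Adj x y) : G.Adj v w := by
  by_contra hvw
  have hvy : G.Adj v y := hF.adj_twin hx hy hv hxy
  have hwx : G.Adj w x := hF.adj_twin hy hx hw hxy.symm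
  have hwy : w ≠ y := by rintro rfl; exact hvw hvy
  have hwF := hF.twinOn_mem hy hw hwy
  obtain ⟨x', hx', hxx', hx'y⟩ : ∃ x' ∈ F, G.Adj x x' ∧ x' ≠ y := by
    obtain ⟨s, hs, t, ht, hxs, hxt, hst, -⟩ := hF.exists_neighbors hx
    by_cases h : s = y
    · exact ⟨t, ht, hxt, fun h' => hst (h.trans h'.symm)⟩
    · exact ⟨s, hs, hxs, h⟩
  have hyx' : ¬ G.Adj y x' := fun h => hF.triangleFree x hx y hy x' hx' hxy h hxx'
  obtain ⟨D, hDF, hx'D, hD, hDy, s, hs, t, ht, hst, htt, hys, hyt, hne, -⟩ :=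
    hF.exists_far_component hy hx' hx'y hyx'
  obtain ⟨z, hz, hzD, hyz, hzx⟩ : ∃ z ∈ F, G.Touches z D ∧ G.Adj y z ∧ z ≠ x := by
    by_cases h : s = x
    · exact ⟨t, ht, htt, hyt, fun h' => hne (h.trans h'.symm)⟩
    · exact ⟨s, hs, hst, hys, h⟩
  have hxz : ¬ G.Adj x z := fun h => hF.triangleFree x hx y hy z hz hxy hyz h
  have hvz : ¬ G.Adj v z := fun h => hxz ((hF.adj_twin_iff hx hz hzx hv).1 h)
  have hvx' : G.Adj v x' := hF.adj_twin hx hx' hv hxx'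
  refine hcap.not_cap (C := insert v D) (a := y) (b := z) (w := w)
    (hD.insert ⟨x', hx'D, hvx'⟩) ?_ ?_ ?_ hyz ⟨v, by simp, hvy.symm⟩
    (hzD.mono (Set.subset_insert _ _)) ?_ ?_ ?_ ?_
  · rintro (rfl | h)
    · exact G.irrefl hvy
    · exact (hDy y h).1 rfl
  · rintro (rfl | h)
    · exact hzx (hF.eq_of_twinOn hz hx hv)
    · exact (hDy z h).2 hyz
  · rintro (rfl | h)
    · exact ((hw x' hx').1 (Or.inr hvx')).elim hx'y hyx'
    · exact hwF (hDF h)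
  · rintro c (rfl | hc) ⟨h1, h2⟩
    · exact hvz h2.symm
    · exact (hDy c hc).2 h1
  · exact ((hw y hy).2 (Or.inl rfl)).resolve_left hwy.symm
  · exact hF.adj_twin hy hz hw hyz
  · rintro ⟨c, rfl | hc, h⟩
    · exact hvw h.symm
    · exact ((hw c (hDF hc)).1 (Or.inr h)).elim (hDy c hc).1 (hDy c hc).2

/-- An edge `vw` would give a hole through `z`, `v` and the component `D` of the nonneighbours of
`x` with `w` added; `x` sees only `v` and `z` on it, a cap. -/
lemma IsCore.not_adj_of_twinOn {F : Set V} (hF : G.IsCore F) (hhole : G.EvenHoleFree)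
    (hcap : G.CapFree) {v w x y : V} (hx : x ∈ F) (hy : y ∈ F) (hv : G.TwinOn F v x)
    (hw : G.TwinOn F w y) (hxy : x ≠ y) (hn : ¬ G.Adj x y) : ¬ G.Adj v w := by
  intro hvw
  have hvx : v ≠ x := by
    rintro rfl
    exact ((hw v hx).1 (Or.inr hvw.symm)).elim hxy fun h => hn h.symm
  have hvF := hF.twinOn_mem hx hv hvx
  have hvxa : G.Adj v x := ((hv x hx).2 (Or.inl rfl)).resolve_left hvx.symm
  have hwx : ¬ G.Adj x w := fun h =>
    ((hw x hx).1 (Or.inr h.symm)).elim hxy fun h' => hn h'.symm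
  have hxw : x ≠ w := by
    rintro rfl
    exact hxy (hF.eq_of_twinOn hx hy hw)
  obtain ⟨D, hDF, hyD, hD, hDx, s, hs, t, ht, hst, htt, hxs, hxt, hne, hnst⟩ :=
    hF.exists_far_component hx hy hxy.symm hn
  -- If `y` saw both `s` and `t`, then `x s y t` would be an induced four-cycle.
  obtain ⟨z, hz, hzD, hxz, hyz⟩ : ∃ z ∈ F, G.Touches z D ∧ G.Adj x z ∧ ¬ G.Adj y z := by
    by_contra! hcon
    have h1 := hcon s hs hst hxs
    have h2 := hcon t ht htt hxt
    exact (hhole.adj_or_adj hxs h1.symm h2 hxt.symm hxy hne).elim hn hnst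
  have hvD : ¬ G.Touches v D := fun ⟨d, hd, h⟩ =>
    ((hv d (hDF hd)).1 (Or.inr h)).elim (hDx d hd).1 (hDx d hd).2
  have hzy : z ≠ y := by rintro rfl; exact hn hxz
  have hwz : ¬ G.Adj z w := fun h => hyz ((hF.adj_twin_iff hy hz hzy hw).1 h.symm)
  have hwC : G.IsConnSet (insert w D) := by
    by_cases h : w = y
    · rw [h, Set.insert_eq_of_mem hyD]
      exact hD
    · exact hD.insert ⟨y, hyD, ((hw y hy).2 (Or.inl rfl)).resolve_left (Ne.symm h)⟩
  have hvz : G.Adj v z := hF.adj_twin hx hz hv hxz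
  refine hcap.not_cap hwC (a := v) (b := z) (w := x) ?_ ?_ ?_ hvz ⟨w, by simp, hvw⟩
    (hzD.mono (Set.subset_insert _ _)) ?_ hvxa.symm hxz ?_
  · rintro (rfl | h)
    · exact G.irrefl hvw
    · exact hvF (hDF h)
  · rintro (rfl | h)
    · exact hwx hxz
    · exact (hDx z h).2 hxz
  · rintro (h | h)
    · exact hxw h
    · exact (hDx x h).1 rfl
  · rintro c (rfl | hc) ⟨h1, h2⟩
    · exact hwz h2
    · exact hvD ⟨c, hc, h1⟩
  · rintro ⟨c, rfl | hc, h⟩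
    · exact hwx h
    · exact (hDx c hc).2 h

/-! ### Maximum cores and pendant vertices. -/

/-- A core with the largest number of vertices. -/
structure IsMaxCore (G : SimpleGraph V) (F : Set V) : Prop extends G.IsCore F where
  ncard_le : ∀ T, G.IsCore T → T.ncard ≤ F.ncard

/-- `r` lies off `F` and has at most one neighbour in `F`. -/
def IsPendant (G : SimpleGraph V) (F : Set V) (r : V) : Prop :=
  r ∉ F ∧ ∀ f ∈ F, ∀ g ∈ F, G.Adj r f → G.Adj r g → f = g

lemma IsMaxCore.not_triangleFreeOn_of_minimal_link [Finite V] {F D : Set V} (hF : G.IsMaxCore F)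
    (hFD : Disjoint F D) (hD : Minimal (G.IsLink F) D) : ¬ G.TriangleFreeOn (F ∪ D) := by
  intro ht
  obtain ⟨x, hx, y, hy, hxy, hn⟩ := hF.exists_not_adj
  have hle := hF.ncard_le (F ∪ D) ⟨ht, hF.noCliqueSep.union hFD hD, x, Or.inl hx, y, Or.inl hy,
    hxy, hn⟩
  obtain ⟨d, hd⟩ := isLink_nonempty hD.prop
  refine absurd hle (not_le.2 (Set.ncard_lt_ncard ?_ (Set.toFinite _)))
  refine ⟨Set.subset_union_left, fun h => ?_⟩
  exact Set.disjoint_left.1 hFD (h (Or.inr hd)) hd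

/-- The neighbours of `r` in `F` are independent by `IsCore.complete_or_twin`, so two of them would
make `{r}` a minimal link and `F ∪ {r}` a larger core. -/
lemma IsMaxCore.isPendant [Finite V] {F : Set V} (hF : G.IsMaxCore F) (hhole : G.EvenHoleFree)
    (hcap : G.CapFree) {r : V} (hr : r ∉ F) (h1 : ¬ ∀ f ∈ F, G.Adj r f)
    (h2 : ¬ ∃ x ∈ F, G.TwinOn F r x) : G.IsPendant F r := by
  have hind : ∀ f ∈ F, ∀ g ∈ F, G.Adj f g → G.Adj r f → ¬ G.Adj r g := fun f hf g hg hfg hrf hrg =>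
    (hF.toIsCore.complete_or_twin hhole hcap hr hf hg hfg hrf hrg).elim h1 h2
  refine ⟨hr, fun f hf g hg hrf hrg => ?_⟩
  by_contra hne
  have hlink : Minimal (G.IsLink F) {r} := by
    refine ⟨⟨isConnSet_singleton r, f, hf, g, hg, hne, fun h => hind f hf g hg h hrf hrg,
      ⟨r, rfl, hrf.symm⟩, ⟨r, rfl, hrg.symm⟩⟩, ?_⟩
    rintro D hD hDr _ rfl
    obtain ⟨d, hd⟩ := isLink_nonempty hD
    have : d = _ := hDr hd
    exact this ▸ hd
  refine hF.not_triangleFreeOn_of_minimal_link (Set.disjoint_singleton_right.2 hr) hlink ?_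
  have hp : G.IsInducedPath (fun _ => r) 0 := ⟨by omega, by omega⟩
  have := hF.triangleFree.union_path hp
    (fun _ _ a ha b hb hab har hbr => hind a ha b hb hab har.symm hbr.symm) (by omega)
  simpa using this

/-- A maximum core has no link consisting of vertices with at most one neighbour in it. -/
lemma IsMaxCore.not_isLink [Finite V] {F C : Set V} (hF : G.IsMaxCore F) (hcap : G.CapFree)
    (hC : ∀ c ∈ C, G.IsPendant F c) : ¬ G.IsLink F C := by
  intro hlink
  obtain ⟨D, hDC, hD⟩ := exists_minimal_le_of_wellFoundedLT (G.IsLink F) C hlink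
  have hFD : Disjoint F D := Set.disjoint_left.2 fun f hf hfD => (hC f (hDC hfD)).1 hf
  refine hF.not_triangleFreeOn_of_minimal_link hFD hD ?_
  obtain ⟨x, hx, y, hy, hxy, hnxy, n, p, hp, rfl, h0, hn, h0', hn'⟩ :=
    exists_inducedPath_of_minimal_link hD
  have hmem : ∀ i ≤ n, p i ∈ p '' Set.Icc 0 n := fun i hi => ⟨i, by simpa using hi, rfl⟩
  have hpend : ∀ i ≤ n, ∀ f ∈ F, ∀ g ∈ F, G.Adj f (p i) → G.Adj g (p i) → f = g :=
    fun i hi f hf g hg hf' hg' => (hC _ (hDC (hmem i hi))).2 f hf g hg hf'.symm hg'.symm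
  have hFp : ∀ f ∈ F, ∀ i ≤ n, f ≠ p i := by
    rintro f hf i hi rfl
    exact Set.disjoint_left.1 hFD hf (hmem i hi)
  refine hF.triangleFree.union_path hp ?_ ?_
  · intro i hi a ha b hb hab hai hbi
    exact hab.ne (hpend i hi a ha b hb hai hbi)
  · intro i
    induction i using Nat.strong_induction_on with
    | _ i ih =>
    intro hi a ha hai hai'
    have hax : a ≠ x := by rintro rfl; exact h0' (i + 1) (by omega) (by omega) hai'
    have hi0 : 0 < i := by
      by_contra h
      obtain rfl : i = 0 := by omega
      exact hax (hpend 0 (by omega) a ha x hx hai h0)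
    -- Otherwise `p 0, …, p i` would be a link from `x` to `a` that omits `p n`.
    have hadj : G.Adj a x := by
      by_contra hnax
      have hsub : p '' Set.Icc 0 i ⊆ p '' Set.Icc 0 n :=
        Set.image_mono (Set.Icc_subset_Icc_right hi.le)
      have hl : G.IsLink F (p '' Set.Icc 0 i) :=
        ⟨by simpa using hp.isConnSet_image 0 i (by omega), a, ha, x, hx, hax, hnax,
          ⟨p i, ⟨i, by simp, rfl⟩, hai⟩, ⟨p 0, ⟨0, by simp, rfl⟩, h0⟩⟩
      obtain ⟨j, ⟨-, hj⟩, hjn⟩ := hD.le_of_le hl hsub (hmem n le_rfl)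
      exact hp.ne j n (by omega) le_rfl hjn
    obtain ⟨k, rfl⟩ : ∃ k, i = k + 1 := ⟨i - 1, by omega⟩
    have hconn : G.IsConnSet (p '' Set.Icc 0 k) := by
      simpa using hp.isConnSet_image 0 k (by omega)
    -- The edge `ax` closes a hole with earlier path vertices, and `p (k + 2)` caps it on `a` and `p
    -- (k + 1)`. The induction hypothesis keeps `a` from seeing both `p k` and `p (k + 1)`.
    refine hcap.not_cap (a := a) (b := p (k + 1)) (w := p (k + 1 + 1))
      (hconn.insert ⟨p 0, ⟨0, by simp, rfl⟩, h0⟩) ?_ ?_ ?_ hai ⟨x, by simp, hadj⟩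
      ⟨p k, Or.inr ⟨k, by simp, rfl⟩, ((hp.adj_iff k (k + 1) (by omega) (by omega)).2 rfl).symm⟩
      ?_ hai'.symm ((hp.adj_iff (k + 1) (k + 1 + 1) (by omega) (by omega)).2 rfl).symm ?_
    · rintro (rfl | ⟨j, ⟨-, hj⟩, rfl⟩)
      · exact hax rfl
      · exact hFp _ ha j (by omega) rfl
    · rintro (h | ⟨j, ⟨-, hj⟩, h⟩)
      · exact hFp x hx _ (by omega) h.symm
      · exact hp.ne j (k + 1) (by omega) (by omega) h
    · rintro (h | ⟨j, ⟨-, hj⟩, h⟩)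
      · exact hFp x hx _ (by omega) h.symm
      · exact hp.ne j (k + 1 + 1) (by omega) (by omega) h
    · rintro c (rfl | ⟨j, ⟨-, hj⟩, rfl⟩) ⟨h1, h2⟩
      · exact h0' (k + 1) (by omega) (by omega) h2.symm
      · obtain rfl : k = j := by
          have := (hp.adj_iff j (k + 1) (by omega) (by omega)).1 h2.symm
          omega
        exact ih k (by omega) (by omega) a ha h1 hai
    · rintro ⟨c, rfl | ⟨j, ⟨-, hj⟩, rfl⟩, h⟩
      · exact h0' (k + 1 + 1) (by omega) (by omega) h.symm
      · have := (hp.adj_iff j (k + 1 + 1) (by omega) (by omega)).1 h.symm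
        omega

lemma IsCore.image {F : Set V} (hF : G.IsCore F) {φ : V → V} (hinj : Set.InjOn φ F)
    (hφ : ∀ a ∈ F, ∀ b ∈ F, (G.Adj (φ a) (φ b) ↔ G.Adj a b)) : G.IsCore (φ '' F) := by
  refine ⟨?_, ?_, ?_⟩
  · rintro _ ⟨a, ha, rfl⟩ _ ⟨b, hb, rfl⟩ _ ⟨c, hc, rfl⟩ hab hbc hac
    exact hF.triangleFree a ha b hb c hc ((hφ a ha b hb).1 hab) ((hφ b hb c hc).1 hbc)
      ((hφ a ha c hc).1 hac)
  · rintro A hA ⟨_, ha⟩ ⟨_, ⟨b, hb, rfl⟩, hbA, hbt⟩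
    obtain ⟨a, haF, rfl⟩ := hA ha
    have ht : ∀ v ∈ F, G.Touches v {w | w ∈ F ∧ φ w ∈ A} → G.Touches (φ v) A := by
      rintro v hv ⟨w, ⟨hw, hwA⟩, h⟩
      exact ⟨φ w, hwA, (hφ v hv w hw).2 h⟩
    obtain ⟨x, hx, y, hy, hxA, hyA, hxt, hyt, hxy, hn⟩ :=
      hF.noCliqueSep {w | w ∈ F ∧ φ w ∈ A} (fun w hw => hw.1) ⟨a, haF, ha⟩
        ⟨b, hb, fun h => hbA h.2, fun h => hbt (ht b hb h)⟩
    exact ⟨φ x, ⟨x, hx, rfl⟩, φ y, ⟨y, hy, rfl⟩, fun h => hxA ⟨hx, h⟩, fun h => hyA ⟨hy, h⟩,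
      ht x hx hxt, ht y hy hyt, fun h => hxy (hinj hx hy h), fun h => hn ((hφ x hx y hy).1 h)⟩
  · obtain ⟨x, hx, y, hy, hxy, hn⟩ := hF.exists_not_adj
    exact ⟨φ x, ⟨x, hx, rfl⟩, φ y, ⟨y, hy, rfl⟩, fun h => hxy (hinj hx hy h),
      fun h => hn ((hφ x hx y hy).1 h)⟩

/-- Replacing a vertex of a maximum core by a twin. -/
lemma IsMaxCore.replace [Finite V] {F : Set V} (hF : G.IsMaxCore F) (hhole : G.EvenHoleFree)
    (hcap : G.CapFree) {x b : V} (hx : x ∈ F) (hb : G.TwinOn F b x) :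
    ∃ F', G.IsMaxCore F' ∧ b ∈ F' ∧ (∀ f ∈ F, f ≠ x → f ∈ F') ∧
      (∀ f ∈ F', f = b ∨ (f ∈ F ∧ f ≠ x)) ∧
      ∀ r, r ≠ b → G.IsPendant F r → G.IsPendant F' r := by
  classical
  have hbF : ∀ f ∈ F, f ≠ x → f ≠ b := by
    rintro f hf hfx rfl
    exact hfx (hF.eq_of_twinOn hf hx hb)
  let φ : V → V := fun v => if v = x then b else v
  have hφx : φ x = b := by simp [φ]
  have hφ : ∀ v, v ≠ x → φ v = v := fun v hv => by simp [φ, hv]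
  have hinj : Set.InjOn φ F := by
    intro v hv w hw hvw
    by_cases h1 : v = x <;> by_cases h2 : w = x
    · exact h1.trans h2.symm
    · rw [h1, hφx, hφ w h2] at hvw; exact absurd hvw.symm (hbF w hw h2)
    · rw [h2, hφx, hφ v h1] at hvw; exact absurd hvw (hbF v hv h1)
    · rwa [hφ v h1, hφ w h2] at hvw
  have hadj : ∀ v ∈ F, ∀ w ∈ F, (G.Adj (φ v) (φ w) ↔ G.Adj v w) := by
    intro v hv w hw
    by_cases h1 : v = x <;> by_cases h2 : w = x
    · subst h1; subst h2; simp
    · rw [h1, hφx, hφ w h2]; exact hF.adj_twin_iff hx hw h2 hb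
    · rw [h2, hφx, hφ v h1, G.adj_comm, G.adj_comm v]; exact hF.adj_twin_iff hx hv h1 hb
    · rw [hφ v h1, hφ w h2]
  have hcore : G.IsMaxCore (φ '' F) :=
    ⟨hF.toIsCore.image hinj hadj, fun T hT => hinj.ncard_image.symm ▸ hF.ncard_le T hT⟩
  have hsub : ∀ f ∈ φ '' F, f = b ∨ (f ∈ F ∧ f ≠ x) := by
    rintro _ ⟨f, hf, rfl⟩
    by_cases h : f = x
    · exact Or.inl (h ▸ hφx)
    · exact Or.inr (by rw [hφ f h]; exact ⟨hf, h⟩)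
  refine ⟨φ '' F, hcore, ⟨x, hx, hφx⟩, fun f hf hfx => ⟨f, hf, hφ f hfx⟩, hsub, ?_⟩
  rintro r hrb ⟨hrF, hr⟩
  have hrF' : r ∉ φ '' F := fun h => (hsub r h).elim hrb fun h' => hrF h'.1
  -- A closed neighbourhood in the new core has at least three vertices; two differ from `b`, and
  -- `r` sees at most one of these.
  have key : ∀ z ∈ φ '' F, ∃ f ∈ φ '' F, (f = z ∨ G.Adj z f) ∧ ¬ G.Adj r f := by
    intro z hz
    by_contra! hcon
    obtain ⟨s, hs, t, ht, hzs, hzt, hst, -⟩ := hcore.exists_neighbors hz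
    have hrz := hcon z hz (Or.inl rfl)
    have hrs := hcon s hs (Or.inr hzs)
    have hrt := hcon t ht (Or.inr hzt)
    rcases hsub z hz with rfl | hz' <;> rcases hsub s hs with rfl | hs' <;>
      rcases hsub t ht with rfl | ht'
    all_goals first
      | exact hst rfl
      | exact hzs.ne rfl
      | exact hzt.ne rfl
      | exact hst (hr _ hs'.1 _ ht'.1 hrs hrt)
      | exact hzs.ne (hr _ hz'.1 _ hs'.1 hrz hrs)
      | exact hzt.ne (hr _ hz'.1 _ ht'.1 hrz hrt)
  refine hcore.isPendant hhole hcap hrF' ?_ ?_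
  · intro h
    obtain ⟨f, hf, -, hrf⟩ := key b ⟨x, hx, hφx⟩
    exact hrf (h f hf)
  · rintro ⟨z, hz, h⟩
    obtain ⟨f, hf, hzf, hrf⟩ := key z hz
    refine hrf (((h f hf).2 hzf).resolve_left ?_)
    rintro rfl
    exact hrF' hf

/-- In a graph without clique cutset, every vertex is complete to a maximum core or a twin of one
of its vertices. -/
lemma IsMaxCore.complete_or_twin_of_noCliqueSep [Finite V] {F : Set V} (hF : G.IsMaxCore F)
    (hhole : G.EvenHoleFree) (hcap : G.CapFree) (hG : G.NoCliqueSep Set.univ) (v : V) :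
    (∀ f ∈ F, G.Adj v f) ∨ ∃ x ∈ F, G.TwinOn F v x := by
  by_contra hv
  let K : Set V := {v | (∀ f ∈ F, G.Adj v f) ∨ ∃ x ∈ F, G.TwinOn F v x}
  have hFK : F ⊆ K := fun f hf => Or.inr ⟨f, hf, fun _ _ => Iff.rfl⟩
  obtain ⟨C, hCK, hvC, hC, hCcl⟩ := exists_component (G := G) Kᶜ (c := v) hv
  have hpend : ∀ c ∈ C, G.IsPendant F c := fun c hc =>
    hF.isPendant hhole hcap (fun h => hCK hc (hFK h)) (fun h => hCK hc (Or.inl h))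
      fun h => hCK hc (Or.inr h)
  have hneC : ∀ k ∈ K, ∀ c ∈ C, c ≠ k := by
    rintro k hk c hc rfl
    exact hCK hc hk
  obtain ⟨b, hb, b', hb', hbt, hbt', hbb', hn⟩ : ∃ b ∈ K, ∃ b' ∈ K, G.Touches b C ∧
      G.Touches b' C ∧ b ≠ b' ∧ ¬ G.Adj b b' := by
    by_cases h : ∀ f ∈ F, G.Touches f C
    · obtain ⟨x, hx, y, hy, hxy, hn⟩ := hF.exists_not_adj
      exact ⟨x, hFK hx, y, hFK hy, h x hx, h y hy, hxy, hn⟩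
    · push Not at h
      obtain ⟨f, hf, hft⟩ := h
      obtain ⟨x, -, y, -, hxC, hyC, hxt, hyt, hxy, hn⟩ := hG C (Set.subset_univ _) ⟨v, hvC⟩
        ⟨f, trivial, fun h => hCK h (hFK hf), hft⟩
      have hmem : ∀ z, z ∉ C → G.Touches z C → z ∈ K := by
        rintro z hzC ⟨c, hc, hzc⟩
        by_contra hz
        exact hzC (hCcl c hc z hz hzc.symm)
      exact ⟨x, hmem x hxC hxt, y, hmem y hyC hyt, hxt, hyt, hxy, hn⟩
  obtain ⟨x, hx, hbx⟩ : ∃ x ∈ F, G.TwinOn F b x := by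
    refine hb.resolve_left fun hb => ?_
    rcases hb' with hb' | ⟨y, hy, hb'⟩
    · exact hn (hF.adj_of_complete hhole hb hb' hbb')
    · exact hn (hF.adj_of_complete_of_twinOn hhole hy hb hb')
  obtain ⟨y, hy, hby⟩ : ∃ y ∈ F, G.TwinOn F b' y :=
    hb'.resolve_left fun hb' => hn (hF.adj_of_complete_of_twinOn hhole hx hb' hbx).symm
  have hxy : x ≠ y := by
    rintro rfl
    exact hn (hF.adj_of_twinOn_same hhole hx hbx hby hbb')
  have hnxy : ¬ G.Adj x y := fun h => hn (hF.adj_of_twinOn_of_adj hcap hx hy hbx hby h)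
  have hby' : ¬ G.Adj b y :=
    hF.not_adj_of_twinOn hhole hcap hx hy hbx (fun _ _ => Iff.rfl) hxy hnxy
  have hbney : b ≠ y := by
    rintro rfl
    exact hxy (hF.eq_of_twinOn hy hx hbx).symm
  -- Exchanging `x` for `b` and `y` for `b'` keeps `C` pendant and makes it a link of a maximum
  -- core.
  obtain ⟨F₁, hF₁, hbF₁, h₁, h₁', hp₁⟩ := hF.replace hhole hcap hx hbx
  have htw : G.TwinOn F₁ b' y := by
    intro f hf
    rcases h₁' f hf with rfl | ⟨hf, -⟩
    · exact ⟨fun h => (h.elim hbb' fun h => hn h.symm).elim,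
        fun h => (h.elim hbney fun h => hby' h.symm).elim⟩
    · exact hby f hf
  obtain ⟨F₂, hF₂, hbF₂, h₂, -, hp₂⟩ := hF₁.replace hhole hcap (h₁ y hy hxy.symm) htw
  refine hF₂.not_isLink hcap (fun c hc => hp₂ c (hneC b' hb' c hc)
    (hp₁ c (hneC b hb c hc) (hpend c hc))) ?_
  exact ⟨hC, b, h₂ b hbF₁ hbney, b', hbF₂, hbb', hn, hbt, hbt'⟩

/-! ### From cores to the whole graph. -/

lemma noCliqueSep_univ [Finite V] (hconn : G.Preconnected)
    (hcut : ¬ ∃ S : Set V, G.IsCliqueCutset S) : G.NoCliqueSep Set.univ := by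
  rintro A - ⟨a, ha⟩ ⟨b, -, hbA, hbt⟩
  by_contra! hcon
  refine hcut ⟨{v | v ∉ A ∧ G.Touches v A}, ?_, ?_⟩
  · rintro x ⟨hxA, hxt⟩ y ⟨hyA, hyt⟩ hxy
    exact hcon x trivial y trivial hxA hyA hxt hyt hxy
  · have h1 : Nat.card G.ConnectedComponent ≤ 1 := by
      have := hconn.subsingleton_connectedComponent
      exact Finite.card_le_one_iff_subsingleton.2 this
    refine lt_of_le_of_lt h1 (Finite.one_lt_card_iff_nontrivial.2 ?_)
    let S : Set V := {v | v ∉ A ∧ G.Touches v A}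
    have haS : a ∈ Sᶜ := fun h => h.1 ha
    have hbS : b ∈ Sᶜ := fun h => hbt h.2
    refine ⟨(G.induce Sᶜ).connectedComponentMk ⟨a, haS⟩,
      (G.induce Sᶜ).connectedComponentMk ⟨b, hbS⟩, fun h => ?_⟩
    obtain ⟨w⟩ := ConnectedComponent.exact h
    have key : ∀ (s t : ↥Sᶜ), (G.induce Sᶜ).Walk s t → s.1 ∈ A → t.1 ∈ A := by
      intro s t w
      induction w with
      | nil => exact id
      | @cons u v _ h _ ih =>
        intro hu
        refine ih ?_
        by_contra hv
        exact v.2 ⟨hv, u.1, hu, (show G.Adj u.1 v.1 from h).symm⟩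
    exact hbA (key _ _ w ha)

end SimpleGraph

theorem mainTheorem2 {V : Type*} [Finite V] (G : SimpleGraph V)
    (hconn : G.Preconnected)
    (hhole : G.EvenHoleFree) (hcap : G.CapFree)
    (huniv : ¬ ∃ v : V, G.IsUniversal v)
    (htwin : ¬ ∃ u v : V, G.AreTwins u v)
    (hcut : ¬ ∃ S : Set V, G.IsCliqueCutset S) :
    G.CliqueFree 3 := by
  classical
  intro t ht
  obtain ⟨a, b, c, hab, hac, hbc, -⟩ := SimpleGraph.is3Clique_iff.1 ht
  have hG := SimpleGraph.noCliqueSep_univ hconn hcut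
  obtain ⟨z, haz, hnaz⟩ : ∃ z, a ≠ z ∧ ¬ G.Adj a z := by
    by_contra! hcon
    exact huniv ⟨a, fun w hw => hcon w hw⟩
  obtain ⟨F, hF⟩ : ∃ F, G.IsMaxCore F := by
    obtain ⟨F, hF, hmax⟩ := Set.exists_max_image {F | G.IsCore F} Set.ncard (Set.toFinite _)
      (hG.exists_isCore trivial trivial haz hnaz)
    exact ⟨F, hF, hmax⟩
  have hall := hF.complete_or_twin_of_noCliqueSep hhole hcap hG
  have hTwin : ∀ v, ∃ x ∈ F, G.TwinOn F v x := by
    intro u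
    refine (hall u).resolve_left fun hu => huniv ⟨u, fun w huw => ?_⟩
    rcases hall w with hw | ⟨x, hx, hw⟩
    · exact hF.adj_of_complete hhole hu hw huw
    · exact hF.adj_of_complete_of_twinOn hhole hx hu hw
  -- `G` arises from `F` by substituting cliques for vertices, so twins on `F` are twins in `G`.
  have hadj : ∀ v x w y, x ∈ F → y ∈ F → G.TwinOn F v x → G.TwinOn F w y →
      ((w = v ∨ G.Adj v w) ↔ (y = x ∨ G.Adj x y)) := by
    intro v x w y hx hy hv hw
    by_cases hxy : x = y
    · subst hxy
      refine iff_of_true ?_ (Or.inl rfl)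
      by_cases hvw : w = v
      · exact Or.inl hvw
      · exact Or.inr (hF.adj_of_twinOn_same hhole hx hv hw (Ne.symm hvw))
    · by_cases h : G.Adj x y
      · exact iff_of_true (Or.inr (hF.adj_of_twinOn_of_adj hcap hx hy hv hw h)) (Or.inr h)
      · refine iff_of_false ?_ (fun h' => h'.elim (Ne.symm hxy) h)
        rintro (rfl | h')
        · exact ((hw x hx).1 ((hv x hx).2 (Or.inl rfl))).elim hxy
            fun h' => h h'.symm
        · exact hF.not_adj_of_twinOn hhole hcap hx hy hv hw hxy h h'
  have hmem : ∀ v, v ∈ F := by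
    intro v
    obtain ⟨x, hx, hv⟩ := hTwin v
    by_contra hvF
    have hvx : v ≠ x := by rintro rfl; exact hvF hx
    refine htwin ⟨v, x, hvx, ?_⟩
    ext w
    obtain ⟨y, hy, hw⟩ := hTwin w
    exact (hadj v x w y hx hy hv hw).trans (hadj x x w y hx hy (fun _ _ => Iff.rfl) hw).symm
  exact hF.triangleFree a (hmem a) b (hmem b) c (hmem c) hab hbc hac
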